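/- Let $V$ be a finite-dimensional vector space over a field $K$ of characteristic $0$. A finite subset $X \subset V$ with $0 \notin X$ and $\langle X\rangle_K = V$ is called a unimodular system of $V$ if, with respect to any fixed linear coordinates on $V$, the determinant of a basis $B \subset X$ of $V$, taken up to sign, does not depend on $B$. Let $n \ge 1$, let $\zeta_n \in \mathbb{C}$ be a primitive $n$-th root of unity, let $d = \varphi(n)$, and let $\omega_1,\ldots,\omega_d$ be all the primitive $n$-th roots of unity in $\mathbb{C}$, listed in any order without repetition. Put $$Z_n = \{z \in \mathbb{C} \mid z^n = 1\}, \qquad \Omega_n = \{(\omega_1^k,\ldots,\omega_d^k) \mid k = 0,1,\ldots,n-1\} \subset \mathbb{C}^d .$$ Then $Z_n \subset \mathbb{Q}(\zeta_n)$, and the following two statements are equivalent: (i) $Z_n$ is a unimodular system of the $\mathbb{Q}$-vector space $\mathbb{Q}(\zeta_n)$; (ii) $\Omega_n$ is a unimodular system of the $\mathbb{C}$-vector space $\mathbb{C}^d$. If $n$ has at most two distinct odd prime factors, then both (i) and (ii) hold. -/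

import Mathlib

open scoped IntermediateField

/-- A subset `X` of a `K`-vector space `V` is a unimodular system of `V`: it is finite, does not
contain `0`, spans `V`, and, for coordinates given by any basis `e` of `V`, the determinant
(up to sign) of a basis of `V` consisting of elements of `X` does not depend on that basis.
A basis `B ⊆ X` is represented by its enumerations `b` by `Fin (dim V)`. -/
structure IsUnimodularSystem (K : Type*) {V : Type*} [Field K] [AddCommGroup V] [Module K V]
    (X : Set V) : Prop where
  finite : X.Finite
  zero_notMem : (0 : V) ∉ X
  span_eq_top : Submodule.span K X = ⊤
  det_eq : ∀ e b b' : Module.Basis (Fin (Module.finrank K V)) K V,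
    (∀ i, b i ∈ X) → (∀ i, b' i ∈ X) → e.det b = e.det b' ∨ e.det b = -e.det b'

/-- The set of all complex `n`-th roots of unity. -/
def rootsOfUnitySet (n : ℕ) : Set ℂ := {z | z ^ n = 1}

/-- The vectors `(ω₁ ^ k, …, ω_d ^ k)`, for `k = 0, …, n - 1`. -/
def powerVectors (n : ℕ) {d : ℕ} (ω : Fin d → ℂ) : Set (Fin d → ℂ) :=
  {v | ∃ k : ℕ, k < n ∧ v = fun i => ω i ^ k}

/-- `n` has at most two distinct odd prime factors. -/
def AtMostTwoOddPrimeFactors (n : ℕ) : Prop :=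
  (n.primeFactors.filter (fun p => Odd p)).card ≤ 2

/-!
The two systems have the same determinants. Expand `ζ ^ m` in the basis `1, ζ, …, ζ ^ (d - 1)` of
`ℚ⟮ζ⟯`; applying the embeddings `ζ ↦ ω i` gives the same expansion of the power vector `(ω i ^ m)`
in the first `d` power vectors, which form a basis by Vandermonde. Relative to these bases, each
system is unimodular if and only if all determinants are `0`, `1` or `-1`
(`isUnimodularSystem_iff`), and `det_pow_eq_algebraMap_det_pow` says that the determinants agree.

If `n` has at most two odd prime factors, any basis of `ℚ⟮ζ⟯` consisting of `n`-th roots of unity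
gives integral coordinates to all of them (`isInt_coeff_of_pow_eq_one`), so the transition matrix
between two such bases is invertible over `ℤ`. To see the integrality, write the expansion of a
root of unity in the basis as a relation `f : ZMod n → ℚ`, `∑ f x * ζ ^ x = 0`. By
`exists_periodic_decomposition`, `f` is a sum of functions, one for each prime `p ∣ n`, invariant
under the shift by `n / p`. This follows from a Bézout identity for cyclotomic polynomials in the
group algebra of `ZMod n`. Up to signs, one may keep just one exponent of each pair `x`, `x + n / 2`
(`IsHalfSystem`), which removes the prime `2` and leaves `f = a + b` with two periodic functions
`a`, `b`. Then `fract a - fract (-b)` is again a relation. It vanishes at every `x` for which `f x`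
is an integer, hence it involves only members of the basis, hence it is zero; so `f` is
integer-valued (`isInt_coeff_of_linearIndependent`).
-/

open Polynomial

/-! ### Relations among roots of unity -/

/-- The geometric sum in `Y = X ^ m` is congruent to the unit `p` modulo `Y - 1`. -/
theorem isCoprime_X_pow_sub_one_geom_sum {p : ℕ} (hp : p ≠ 0) (m : ℕ) :
    IsCoprime (X ^ m - 1 : ℚ[X]) (∑ i ∈ Finset.range p, (X ^ m) ^ i) := by
  have h : (X ^ m - 1 : ℚ[X]) ∣ (∑ i ∈ Finset.range p, (X ^ m) ^ i) - C (p : ℚ) := by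
    have : (∑ i ∈ Finset.range p, (X ^ m : ℚ[X]) ^ i) - C (p : ℚ)
        = ∑ i ∈ Finset.range p, ((X ^ m : ℚ[X]) ^ i - 1) := by simp
    rw [this]
    exact Finset.dvd_sum fun i _ => by simpa using sub_dvd_pow_sub_pow (X ^ m : ℚ[X]) 1 i
  obtain ⟨q, hq⟩ := h
  refine ⟨-(C (p : ℚ)⁻¹ * q), C (p : ℚ)⁻¹, ?_⟩
  have hc : (C (p : ℚ)⁻¹ : ℚ[X]) * C (p : ℚ) = 1 := by
    rw [← C_mul, inv_mul_cancel₀ (by exact_mod_cast hp), C_1]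
  linear_combination (C (p : ℚ)⁻¹ : ℚ[X]) * hq + hc

/-- The gcd of `X ^ n - 1` and the quotients `(X ^ n - 1) / (X ^ (n / p) - 1)`, for the primes
`p ∣ n`, divides the cyclotomic polynomial: no `n`-th root of unity of smaller order is a common
root. The generator `X ^ n - 1` is needed only for `n = 1`, where there is no prime `p`. -/
theorem cyclotomic_mem_span {n : ℕ} (hn : 0 < n) :
    cyclotomic n ℚ ∈ Ideal.span {(X ^ n - 1 : ℚ[X])} ⊔
      ⨆ p : n.primeFactors,
        Ideal.span {∑ i ∈ Finset.range (p : ℕ), ((X : ℚ[X]) ^ (n / (p : ℕ))) ^ i} := by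
  set I := Ideal.span {(X ^ n - 1 : ℚ[X])} ⊔
      ⨆ p : n.primeFactors,
        Ideal.span {∑ i ∈ Finset.range (p : ℕ), ((X : ℚ[X]) ^ (n / (p : ℕ))) ^ i} with hI
  obtain ⟨g, hg⟩ := (IsPrincipalIdealRing.principal I).principal
  have hg1 : g ∣ X ^ n - 1 := by
    rw [← Ideal.mem_span_singleton, ← Ideal.submodule_span_eq, ← hg]
    exact Ideal.mem_sup_left (Ideal.mem_span_singleton_self _)
  have hg2 : ∀ p ∈ n.primeFactors, g ∣ ∑ i ∈ Finset.range p, (X ^ (n / p)) ^ i := by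
    intro p hp
    rw [← Ideal.mem_span_singleton, ← Ideal.submodule_span_eq, ← hg]
    exact Ideal.mem_sup_right (Ideal.mem_iSup_of_mem (⟨p, hp⟩ : n.primeFactors)
      (Ideal.mem_span_singleton_self _))
  rw [hg, Ideal.submodule_span_eq, Ideal.mem_span_singleton]
  rw [← prod_cyclotomic_eq_X_pow_sub_one hn, ← Nat.cons_self_properDivisors hn.ne',
    Finset.prod_cons] at hg1
  refine IsCoprime.dvd_of_dvd_mul_right (IsCoprime.prod_right fun d hd => ?_) hg1
  rw [Nat.mem_properDivisors] at hd
  obtain ⟨⟨k, hk⟩, hlt⟩ := hd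
  have hk1 : k ≠ 1 := by rintro rfl; omega
  have hp := Nat.minFac_prime hk1
  have hpn : k.minFac ∣ n := hk ▸ (Nat.minFac_dvd k).mul_left d
  -- A proper divisor `d` of `n` divides some `n / p`, and there `X ^ (n / p) - 1` is coprime to `g`.
  have hd : d ∣ n / k.minFac := by
    obtain ⟨l, hl⟩ := Nat.minFac_dvd k
    refine ⟨l, Nat.div_eq_of_eq_mul_right hp.pos ?_⟩
    calc n = d * k := hk
      _ = d * (k.minFac * l) := by rw [← hl]
      _ = _ := by ring
  have hcop := isCoprime_X_pow_sub_one_geom_sum hp.ne_zero (n / k.minFac)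
  refine (hcop.symm.of_isCoprime_of_dvd_left
    (hg2 _ (Nat.mem_primeFactors.2 ⟨hp, hpn, hn.ne'⟩))).of_isCoprime_of_dvd_right ?_
  have hpos : 0 < n / k.minFac := Nat.div_pos (Nat.le_of_dvd hn hpn) hp.pos
  rw [← prod_cyclotomic_eq_X_pow_sub_one hpos]
  exact Finset.dvd_prod_of_mem _ (Nat.mem_divisors.2 ⟨hd, hpos.ne'⟩)

theorem pow_val_natCast {n : ℕ} {ζ : ℂ} (hζ : ζ ^ n = 1) (k : ℕ) :
    ζ ^ (k : ZMod n).val = ζ ^ k := by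
  rw [ZMod.val_natCast, ← pow_eq_pow_mod k hζ]

theorem pow_val_add {n : ℕ} [NeZero n] {ζ : ℂ} (hζ : ζ ^ n = 1) (x y : ZMod n) :
    ζ ^ (x + y).val = ζ ^ x.val * ζ ^ y.val := by
  rw [ZMod.val_add, ← pow_eq_pow_mod _ hζ, pow_add]

/-- The sum is multiplied by `ζ ^ (n / p) ≠ 1` under the shift that leaves `a` unchanged. -/
theorem sum_mul_pow_eq_zero_of_periodic {n : ℕ} [NeZero n] {ζ : ℂ} (hζ : IsPrimitiveRoot ζ n)
    {p : ℕ} (hp : p ∈ n.primeFactors) {a : ZMod n → ℚ}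
    (ha : ∀ x, a (x + (n / p : ℕ)) = a x) :
    ∑ x, (a x : ℂ) * ζ ^ x.val = 0 := by
  have h : ∑ x, (a x : ℂ) * ζ ^ x.val = ζ ^ (n / p) * ∑ x, (a x : ℂ) * ζ ^ x.val := by
    conv_lhs => rw [← Equiv.sum_comp (Equiv.addRight ((n / p : ℕ) : ZMod n))]
    rw [Finset.mul_sum]
    refine Finset.sum_congr rfl fun x _ => ?_
    rw [Equiv.coe_addRight, ha, pow_val_add hζ.pow_eq_one, pow_val_natCast hζ.pow_eq_one]
    ring
  have hpp := Nat.prime_of_mem_primeFactors hp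
  have hne : ζ ^ (n / p) ≠ 1 := hζ.pow_ne_one_of_pos_of_lt
    (Nat.div_pos (Nat.le_of_mem_primeFactors hp) hpp.pos).ne'
    (Nat.div_lt_self (NeZero.pos n) hpp.one_lt)
  by_contra h0
  exact hne (mul_right_cancel₀ h0 (by rw [one_mul, ← h]))

/-- The rational relations among the `n`-th roots of unity are generated by the obvious ones: a
relation is a sum, over the primes `p ∣ n`, of functions constant on the cosets of the subgroup
of order `p`. -/
theorem exists_periodic_decomposition {n : ℕ} [NeZero n] {ζ : ℂ} (hζ : IsPrimitiveRoot ζ n)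
    {f : ZMod n → ℚ} (hf : ∑ x, (f x : ℂ) * ζ ^ x.val = 0) :
    ∃ a : ℕ → ZMod n → ℚ,
      (∀ p ∈ n.primeFactors, ∀ x, a p (x + (n / p : ℕ)) = a p x) ∧
      ∀ x, f x = ∑ p ∈ n.primeFactors, a p x := by
  have hn := NeZero.pos n
  let φ : ℚ[X] →ₐ[ℚ] AddMonoidAlgebra ℚ (ZMod n) := aeval (AddMonoidAlgebra.single (1 : ZMod n) 1)
  have hφ : ∀ k : ℕ, φ (X ^ k) = AddMonoidAlgebra.single (k : ZMod n) 1 := by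
    intro k
    simp [φ, AddMonoidAlgebra.single_pow]
  let F : ℚ[X] := ∑ x : ZMod n, C (f x) * X ^ x.val
  have hF : ∀ y, (φ F).coeff y = f y := by
    intro y
    simp only [F, map_sum, ← smul_eq_C_mul, map_smul, hφ]
    simp [AddMonoidAlgebra.coeff_sum, Finsupp.single_apply]
  have hdvd : cyclotomic n ℚ ∣ F := by
    rw [cyclotomic_eq_minpoly_rat hζ hn]
    refine minpoly.dvd ℚ ζ ?_
    simpa [F] using hf
  have hmem := Ideal.mul_mem_right (hdvd.choose) _ (cyclotomic_mem_span hn)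
  rw [← hdvd.choose_spec, Submodule.mem_sup] at hmem
  obtain ⟨u, hu, w, hw, huw⟩ := hmem
  obtain ⟨v, hv, hvw⟩ := (Submodule.mem_iSup_iff_exists_finsupp _ _).1 hw
  have hun : φ u = 0 := by
    obtain ⟨q, rfl⟩ := Ideal.mem_span_singleton.1 hu
    rw [map_mul, map_sub, hφ]
    simp [AddMonoidAlgebra.one_def]
  refine ⟨fun p x => if h : p ∈ n.primeFactors then (φ (v ⟨p, h⟩)).coeff x else 0, ?_, ?_⟩
  · intro p hp x
    simp only [hp, dite_true]
    obtain ⟨q, hq⟩ := Ideal.mem_span_singleton.1 (hv ⟨p, hp⟩)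
    -- `v p` is killed by `X ^ (n / p) - 1` modulo `X ^ n - 1`, i.e. is invariant under the shift.
    have h1 : φ (X ^ (n / p)) * φ (v ⟨p, hp⟩) = φ (v ⟨p, hp⟩) := by
      rw [← sub_eq_zero, ← sub_one_mul, ← map_one φ, ← map_sub, ← map_mul, hq, ← mul_assoc,
        mul_geom_sum, ← pow_mul, Nat.div_mul_cancel (Nat.dvd_of_mem_primeFactors hp), map_mul,
        map_sub, hφ]
      simp [AddMonoidAlgebra.one_def]
    conv_lhs => rw [← h1, hφ]
    simp
  · intro x
    rw [← hF x, ← huw, map_add, hun, zero_add, ← hvw, Finsupp.sum_fintype _ _ (fun _ => rfl),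
      map_sum, AddMonoidAlgebra.coeff_sum, Finset.sum_apply', ← Finset.sum_attach n.primeFactors]
    refine Finset.sum_congr rfl fun p _ => ?_
    simp

/-! ### Half systems and odd periodic functions -/

/-- A set of exponents modulo `n` that represents the `n`-th roots of unity up to sign: all
exponents if `n` is odd, and one from each pair `x`, `x + n / 2` if `n` is even. Moreover it is
required to be invariant under the shift by `n / p` for each odd prime `p ∣ n`. -/
structure IsHalfSystem {n : ℕ} (H : Set (ZMod n)) : Prop where
  shift : ∀ p ∈ n.primeFactors, Odd p → ∀ x : ZMod n, x + (n / p : ℕ) ∈ H ↔ x ∈ H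
  antipodal : (Odd n ∧ ∀ x, x ∈ H) ∨ (Even n ∧ ∀ x : ZMod n, x + (n / 2 : ℕ) ∈ H ↔ x ∉ H)

theorem exists_isHalfSystem (n : ℕ) [NeZero n] : ∃ H : Set (ZMod n), IsHalfSystem H := by
  rcases Nat.even_or_odd n with he | ho
  swap
  · exact ⟨Set.univ, by simp, Or.inl ⟨ho, fun _ => trivial⟩⟩
  obtain ⟨k, m, hm, hnkm⟩ := Nat.exists_eq_two_pow_mul_odd (NeZero.ne n)
  obtain ⟨k, rfl⟩ : ∃ l, k = l + 1 := by
    refine Nat.exists_eq_succ_of_ne_zero ?_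
    rintro rfl
    rw [pow_zero, one_mul] at hnkm
    exact (Nat.not_even_iff_odd.2 hm) (hnkm ▸ he)
  have hdvd : 2 ^ (k + 1) ∣ n := ⟨m, hnkm⟩
  have hval : ∀ (x : ZMod n) (j : ℕ),
      (x + (j : ℕ)).val % 2 ^ (k + 1) = (x.val + j) % 2 ^ (k + 1) := by
    intro x j
    rw [ZMod.val_add, ZMod.val_natCast, Nat.add_mod_mod, Nat.mod_mod_of_dvd _ hdvd]
  refine ⟨{x | x.val % 2 ^ (k + 1) < 2 ^ k}, ?_, Or.inr ⟨he, ?_⟩⟩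
  · intro p hp hodd x
    obtain ⟨l, hl⟩ : 2 ^ (k + 1) ∣ n / p := by
      refine Nat.Coprime.dvd_of_dvd_mul_right (n := p) ?_ ?_
      · exact (Nat.coprime_two_left.2 hodd).pow_left _
      · rwa [Nat.div_mul_cancel (Nat.dvd_of_mem_primeFactors hp)]
    simp only [Set.mem_ofPred_eq, hval, hl, Nat.add_mul_mod_self_left]
  · intro x
    obtain ⟨j, rfl⟩ := hm
    have hn2 : n / 2 = 2 ^ k + 2 ^ (k + 1) * j := by
      rw [hnkm]
      refine Nat.div_eq_of_eq_mul_right two_pos ?_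
      ring
    simp only [Set.mem_ofPred_eq, hval, hn2, ← add_assoc, Nat.add_mul_mod_self_left]
    rw [Nat.add_mod]
    have h2 : (2 : ℕ) ^ (k + 1) = 2 ^ k + 2 ^ k := by ring
    have hpos : 0 < 2 ^ k := by positivity
    rw [h2]
    generalize 2 ^ k = t at *
    have hlt := Nat.mod_lt x.val (show t + t > 0 by omega)
    rw [Nat.mod_eq_of_lt (show t < t + t by omega)]
    by_cases hc : x.val % (t + t) < t
    · rw [Nat.mod_eq_of_lt (by omega)]
      omega
    · rw [Nat.mod_eq_sub_mod (by omega), Nat.mod_eq_of_lt (by omega)]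
      omega

/-- A function on the exponents modulo `n` that is invariant under the shift by `n / p` for some
odd prime `p ∣ n`. The zero function is included separately, because `n` need not have an odd
prime factor. -/
def IsOddPeriodic {n : ℕ} (a : ZMod n → ℚ) : Prop :=
  a = 0 ∨ ∃ p ∈ n.primeFactors, Odd p ∧ ∀ x, a (x + (n / p : ℕ)) = a x

namespace IsOddPeriodic

variable {n : ℕ} {a : ZMod n → ℚ}

theorem comp (ha : IsOddPeriodic a) {r : ℚ → ℚ} (hr : r 0 = 0) :
    IsOddPeriodic fun x => r (a x) := by
  rcases ha with rfl | ⟨p, hp, ho, h⟩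
  · exact Or.inl (funext fun _ => hr)
  · exact Or.inr ⟨p, hp, ho, fun x => by simp only [h]⟩

theorem indicator (ha : IsOddPeriodic a) {H : Set (ZMod n)}
    (hH : IsHalfSystem H) :
    IsOddPeriodic (H.indicator a) := by
  classical
  rcases ha with rfl | ⟨p, hp, ho, h⟩
  · exact Or.inl (by simp)
  · exact Or.inr ⟨p, hp, ho, fun x => by simp only [Set.indicator_apply, h, hH.shift p hp ho]⟩

theorem sub_shift (ha : IsOddPeriodic a) (s : ZMod n) :
    IsOddPeriodic fun x => a x - a (x + s) := by
  rcases ha with rfl | ⟨p, hp, ho, h⟩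
  · exact Or.inl (by ext; simp)
  · exact Or.inr ⟨p, hp, ho, fun x => by simp only [add_right_comm x _ s, h]⟩

theorem sum_eq_zero [NeZero n] {ζ : ℂ} (hζ : IsPrimitiveRoot ζ n) (ha : IsOddPeriodic a) :
    ∑ x, (a x : ℂ) * ζ ^ x.val = 0 := by
  rcases ha with rfl | ⟨p, hp, -, h⟩
  · simp
  · exact sum_mul_pow_eq_zero_of_periodic hζ hp h

end IsOddPeriodic

theorem exists_isOddPeriodic_add {n : ℕ} (hodd : AtMostTwoOddPrimeFactors n)
    {a : ℕ → ZMod n → ℚ}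
    (ha : ∀ p ∈ n.primeFactors, ∀ x, a p (x + (n / p : ℕ)) = a p x) :
    ∃ b c : ZMod n → ℚ, IsOddPeriodic b ∧ IsOddPeriodic c ∧
      ∀ x, ∑ p ∈ n.primeFactors with Odd p, a p x = b x + c x := by
  unfold AtMostTwoOddPrimeFactors at hodd
  have hper : ∀ p ∈ n.primeFactors.filter (fun p => Odd p), IsOddPeriodic (a p) := by
    intro p hp
    rw [Finset.mem_filter] at hp
    exact Or.inr ⟨p, hp.1, hp.2, ha p hp.1⟩
  have hc : (n.primeFactors.filter (fun p => Odd p)).card = 0 ∨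
    (n.primeFactors.filter (fun p => Odd p)).card = 1 ∨
    (n.primeFactors.filter (fun p => Odd p)).card = 2 := by omega
  rcases hc with h | h | h
  · rw [Finset.card_eq_zero] at h
    exact ⟨0, 0, Or.inl rfl, Or.inl rfl, by simp [h]⟩
  · obtain ⟨p, h⟩ := Finset.card_eq_one.1 h
    exact ⟨a p, 0, hper p (by simp [h]), Or.inl rfl, by simp [h]⟩
  · obtain ⟨p, q, hpq, h⟩ := Finset.card_eq_two.1 h
    exact ⟨a p, a q, hper p (by simp [h]), hper q (by simp [h]),
      by simp [h, Finset.sum_pair hpq]⟩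

/-- A relation supported on a half system is there a sum of only two periodic functions, because
the prime `2` does not contribute. -/
theorem exists_isOddPeriodic_eqOn {n : ℕ} [NeZero n] {ζ : ℂ} (hζ : IsPrimitiveRoot ζ n)
    (hodd : AtMostTwoOddPrimeFactors n) {H : Set (ZMod n)}
    (hH : IsHalfSystem H)
    {f : ZMod n → ℚ} (hf : ∑ x, (f x : ℂ) * ζ ^ x.val = 0) (hfH : ∀ x ∉ H, f x = 0) :
    ∃ a b : ZMod n → ℚ, IsOddPeriodic a ∧ IsOddPeriodic b ∧ ∀ x ∈ H, f x = a x + b x := by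
  obtain ⟨c, hc, hfc⟩ := exists_periodic_decomposition hζ hf
  obtain ⟨a, b, ha, hb, hab⟩ := exists_isOddPeriodic_add hodd hc
  rcases hH.antipodal with ⟨hn, -⟩ | ⟨he, hH⟩
  · refine ⟨a, b, ha, hb, fun x _ => ?_⟩
    rw [← hab, hfc, Finset.filter_true_of_mem]
    exact fun p hp => hn.of_dvd_nat (Nat.dvd_of_mem_primeFactors hp)
  · have h2 : 2 ∈ n.primeFactors :=
      Nat.mem_primeFactors.2 ⟨Nat.prime_two, he.two_dvd, NeZero.ne n⟩
    have hdec : ∀ x, f x = c 2 x + (a x + b x) := by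
      intro x
      have h2' : n.primeFactors.filter (fun p => ¬ Odd p) = {2} := by
        ext p
        simp only [Finset.mem_filter, Finset.mem_singleton]
        constructor
        · rintro ⟨hp, ho⟩
          exact (Nat.prime_of_mem_primeFactors hp).eq_two_or_odd'.resolve_right ho
        · rintro rfl
          exact ⟨h2, by decide⟩
      rw [hfc, ← Finset.sum_filter_add_sum_filter_not _ (fun p => Odd p), hab, h2',
        Finset.sum_singleton, add_comm]
    -- Antisymmetrizing under the shift by `n / 2` removes the summand belonging to the prime `2`.
    refine ⟨_, _, ha.sub_shift (n / 2 : ℕ), hb.sub_shift (n / 2 : ℕ), fun x hx => ?_⟩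
    have h0 := hfH (x + (n / 2 : ℕ)) (by rw [hH]; exact not_not.2 hx)
    have h1 := hdec (x + (n / 2 : ℕ))
    rw [hc 2 h2, h0] at h1
    linarith [hdec x]

/-- If a root of unity is a rational combination of linearly independent ones, all with exponents
in one half system, then the coefficients are integers. This is the rounding argument by which the
incidence matrix of a bipartite graph is totally unimodular: a relation has the form `a + b`, and
`fract a - fract (-b)` is again a relation, which vanishes wherever `a + b` is an integer. -/
theorem isInt_coeff_of_linearIndependent {n : ℕ} [NeZero n] {ζ : ℂ} (hζ : IsPrimitiveRoot ζ n)
    (hodd : AtMostTwoOddPrimeFactors n) {H : Set (ZMod n)}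
    (hH : IsHalfSystem H)
    {ι : Type*} [Fintype ι] {k : ι → ZMod n}
    (hk : LinearIndependent ℚ fun i => ζ ^ (k i).val) (hkH : ∀ i, k i ∈ H)
    {z : ZMod n} (hz : z ∈ H) {c : ι → ℚ}
    (hc : ∑ i, (c i : ℂ) * ζ ^ (k i).val = ζ ^ z.val) (i : ι) :
    ∃ m : ℤ, c i = m := by
  classical
  have hkinj : Function.Injective k := by
    intro i j hij
    exact hk.injective (by simp only [hij])
  -- The relation expressing `ζ ^ z` through the `ζ ^ k i`.
  let f : ZMod n → ℚ := fun x => (∑ i, if k i = x then c i else 0) - if z = x then 1 else 0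
  have hfH : ∀ x ∉ H, f x = 0 := by
    intro x hx
    have h1 : ∀ i, k i ≠ x := fun i h => hx (h ▸ hkH i)
    have h2 : z ≠ x := fun h => hx (h ▸ hz)
    simp [f, h1, h2]
  have hf : ∑ x, (f x : ℂ) * ζ ^ x.val = 0 := by
    simp only [f, Rat.cast_sub, Rat.cast_sum, sub_mul, Finset.sum_sub_distrib, Finset.sum_mul]
    rw [Finset.sum_comm]
    simp [apply_ite (Rat.cast : ℚ → ℂ), ite_mul, hc]
  obtain ⟨a, b, ha, hb, hab⟩ := exists_isOddPeriodic_eqOn hζ hodd hH hf hfH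
  have key : ∀ x ∈ H, (∃ m : ℤ, f x = m) ↔ Int.fract (a x) = Int.fract (-b x) := by
    intro x hx
    rw [Int.fract_eq_fract, hab x hx, sub_neg_eq_add]
  have ha' := ((ha.comp Int.fract_zero).indicator hH).sum_eq_zero hζ
  have hb' := ((hb.comp (r := fun t => Int.fract (-t)) (by simp)).indicator hH).sum_eq_zero hζ
  let g : ZMod n → ℚ := fun x => H.indicator (fun x => Int.fract (a x)) x -
    H.indicator (fun x => Int.fract (-b x)) x
  have hg : ∑ x, (g x : ℂ) * ζ ^ x.val = 0 := by
    simp only [g, Rat.cast_sub, sub_mul, Finset.sum_sub_distrib, ha', hb', sub_zero]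
  -- Outside the exponents `k i`, the relation `f` has the integer values `0` and `-1`.
  have hg0 : ∀ x, x ∉ Set.range k → g x = 0 := by
    intro x hx
    by_cases hxH : x ∈ H
    · simp only [g, Set.indicator_of_mem hxH, sub_eq_zero]
      refine (key x hxH).1 ⟨if z = x then -1 else 0, ?_⟩
      have h1 : ∀ i, k i ≠ x := fun i h => hx ⟨i, h⟩
      split_ifs with h <;> simp [f, h1, h]
    · simp [g, hxH]
  have hgk : ∑ i, g (k i) • ζ ^ (k i).val = 0 := by
    rw [← hg]
    simp only [Rat.smul_def]
    exact Fintype.sum_of_injective k hkinj _ _ (fun x hx => by simp [hg0 x hx]) fun _ => rfl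
  have hi := Fintype.linearIndependent_iff.1 hk _ hgk i
  simp only [g, Set.indicator_of_mem (hkH i), sub_eq_zero] at hi
  obtain ⟨m, hm⟩ := (key _ (hkH i)).2 hi
  refine ⟨m + if z = k i then 1 else 0, ?_⟩
  have : f (k i) = c i - if z = k i then 1 else 0 := by
    simp [f, hkinj.eq_iff]
  push_cast
  rw [← hm, this]
  split_ifs <;> simp

/-! ### Coordinates with respect to bases of roots of unity -/

theorem IsHalfSystem.exists_eq_units_smul {n : ℕ} [NeZero n] {ζ : ℂ} (hζ : IsPrimitiveRoot ζ n)
    {H : Set (ZMod n)} (hH : IsHalfSystem H) {w : ℂ} (hw : w ^ n = 1) :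
    ∃ x ∈ H, ∃ ε : ℤˣ, ζ ^ x.val = ε • w := by
  obtain ⟨j, -, rfl⟩ := hζ.eq_pow_of_pow_eq_one hw
  by_cases hj : (j : ZMod n) ∈ H
  · exact ⟨j, hj, 1, by rw [one_smul, pow_val_natCast hζ.pow_eq_one]⟩
  obtain ⟨he, hanti⟩ := hH.antipodal.resolve_left fun h => hj (h.2 _)
  have hhalf : ζ ^ (n / 2) = -1 := by
    have hpos := NeZero.pos n
    have h2 : 2 ≤ n := Nat.le_of_dvd hpos he.two_dvd
    refine (sq_eq_one_iff.1 ?_).resolve_left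
      (hζ.pow_ne_one_of_pos_of_lt (by omega) (by omega))
    rw [← pow_mul, Nat.div_mul_cancel he.two_dvd, hζ.pow_eq_one]
  refine ⟨j + (n / 2 : ℕ), (hanti _).2 hj, -1, ?_⟩
  rw [pow_val_add hζ.pow_eq_one, pow_val_natCast hζ.pow_eq_one, pow_val_natCast hζ.pow_eq_one,
    hhalf, mul_neg_one, Units.neg_smul, one_smul]

theorem intCast_units_mul_self {R : Type*} [Ring R] (ε : ℤˣ) :
    ((ε : ℤ) : R) * ((ε : ℤ) : R) = 1 := by
  rcases Int.units_eq_one_or ε with rfl | rfl <;> simp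

/-- Any half system serves: moving the exponents into it changes the roots of unity, and hence the
coefficients, only by signs. -/
theorem isInt_coeff_of_pow_eq_one {n : ℕ} [NeZero n] {ζ : ℂ} (hζ : IsPrimitiveRoot ζ n)
    (hodd : AtMostTwoOddPrimeFactors n) {ι : Type*} [Fintype ι] {b : ι → ℂ}
    (hb : LinearIndependent ℚ b) (hbn : ∀ i, b i ^ n = 1) {z : ℂ} (hz : z ^ n = 1) {c : ι → ℚ}
    (hc : ∑ i, c i • b i = z) (i : ι) : ∃ m : ℤ, c i = m := by
  obtain ⟨H, hH⟩ := exists_isHalfSystem n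
  choose k hkH ε hε using fun i => hH.exists_eq_units_smul hζ (hbn i)
  obtain ⟨x, hx, δ, hδ⟩ := hH.exists_eq_units_smul hζ hz
  have hk : LinearIndependent ℚ fun i => ζ ^ (k i).val := by
    simpa only [hε, Pi.smul_def'] using hb.group_smul ε
  obtain ⟨m, hm⟩ := isInt_coeff_of_linearIndependent hζ hodd hH hk hkH hx
    (c := fun i => (((δ : ℤ) * (ε i : ℤ) : ℤ) : ℚ) * c i) (by
      rw [hδ, ← hc, Finset.smul_sum]
      refine Finset.sum_congr rfl fun i _ => ?_
      rw [hε]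
      simp only [Units.smul_def, zsmul_eq_mul, Rat.smul_def]
      have h1 : ((ε i : ℤ) : ℂ) * ((ε i : ℤ) : ℂ) = 1 :=
        intCast_units_mul_self (ε i)
      push_cast
      linear_combination (((δ : ℤ) : ℂ) * (c i : ℂ) * b i) * h1) i
  refine ⟨(δ : ℤ) * (ε i : ℤ) * m, ?_⟩
  have h1 : ((ε i : ℤ) : ℚ) * ((ε i : ℤ) : ℚ) = 1 :=
    intCast_units_mul_self (ε i)
  have h2 : ((δ : ℤ) : ℚ) * ((δ : ℤ) : ℚ) = 1 :=
    intCast_units_mul_self δ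
  push_cast at hm ⊢
  rw [← hm]
  linear_combination (-(c i) * ((δ : ℤ) : ℚ) * ((δ : ℤ) : ℚ)) * h1 - c i * h2

/-! ### Unimodularity in terms of one basis -/

/-- If `X` contains a basis `e`, then the common value, up to sign, of the determinants relative to
`e` can only be `det e = 1`. -/
theorem isUnimodularSystem_iff {K V ι : Type*} [Field K] [AddCommGroup V] [Module K V]
    [Fintype ι] [DecidableEq ι] {X : Set V} (hfin : X.Finite) (h0 : (0 : V) ∉ X)
    (e : Module.Basis ι K V) (he : ∀ i, e i ∈ X) :
    IsUnimodularSystem K X ↔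
      ∀ v : ι → V, (∀ i, v i ∈ X) → e.det v = 0 ∨ e.det v = 1 ∨ e.det v = -1 := by
  let σ : ι ≃ Fin (Module.finrank K V) :=
    Fintype.equivFinOfCardEq (Module.finrank_eq_card_basis e).symm
  constructor
  · intro h v hv
    by_cases hdet : e.det v = 0
    · exact Or.inl hdet
    refine Or.inr ?_
    obtain ⟨hli, hsp⟩ := e.is_basis_iff_det.2 (isUnit_iff_ne_zero.2 hdet)
    let b := Module.Basis.mk hli hsp.ge
    have hb : (b : ι → V) = v := Module.Basis.coe_mk _ _
    have := h.det_eq (e.reindex σ) (b.reindex σ) (e.reindex σ)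
      (fun i => by simpa [hb] using hv _) (fun i => by simpa using he _)
    rw [Module.Basis.det_self, Module.Basis.det_reindex] at this
    simpa [Function.comp_def, hb] using this
  · intro h
    refine ⟨hfin, h0, ?_, fun e' b b' hb hb' => ?_⟩
    · rw [eq_top_iff, ← e.span_eq]
      exact Submodule.span_mono (Set.range_subset_iff.2 he)
    · let f := e.reindex σ
      have hunit : ∀ c : Module.Basis (Fin (Module.finrank K V)) K V, (∀ i, c i ∈ X) →
          f.det c = 1 ∨ f.det c = -1 := by
        intro c hcX
        have hne := (f.isUnit_det c).ne_zero
        have hdet : f.det c = e.det (c ∘ σ) := Module.Basis.det_reindex _ _ _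
        rw [hdet] at hne ⊢
        exact (h _ fun i => hcX _).resolve_left hne
      rw [← e'.det_mul_det f b, ← e'.det_mul_det f b']
      rcases hunit b hb with h1 | h1 <;> rcases hunit b' hb' with h2 | h2 <;> simp [h1, h2]

theorem det_eq_one_or_neg_one_of_isInt {K V ι : Type*} [Field K] [CharZero K] [AddCommGroup V]
    [Module K V] [Fintype ι] [DecidableEq ι] (e b : Module.Basis ι K V)
    (heb : ∀ i j, ∃ m : ℤ, e.repr (b j) i = m) (hbe : ∀ i j, ∃ m : ℤ, b.repr (e j) i = m) :
    e.det b = 1 ∨ e.det b = -1 := by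
  choose M hM using heb
  choose N hN using hbe
  have h1 : e.det b = ((Matrix.of M).det : ℤ) := by
    rw [Module.Basis.det_apply, Int.cast_det]
    congr 1
    ext i j
    simp [Module.Basis.toMatrix_apply, hM]
  have h2 : b.det e = ((Matrix.of N).det : ℤ) := by
    rw [Module.Basis.det_apply, Int.cast_det]
    congr 1
    ext i j
    simp [Module.Basis.toMatrix_apply, hN]
  have h3 : (Matrix.of M).det * (Matrix.of N).det = 1 := by
    have := e.det_mul_det b e
    rw [e.det_self, h1, h2] at this
    exact_mod_cast this
  rw [h1]
  rcases Int.isUnit_iff.1 (IsUnit.of_mul_eq_one _ h3) with h | h <;> simp [h]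

/-! ### Comparison of the two systems -/

theorem exists_powerBasis {n : ℕ} (hn : 0 < n) {ζ : ℂ} (hζ : IsPrimitiveRoot ζ n) :
    ∃ e : Module.Basis (Fin (Nat.totient n)) ℚ ℚ⟮ζ⟯,
      ∀ i, e i = IntermediateField.AdjoinSimple.gen ℚ ζ ^ (i : ℕ) := by
  let pb := IntermediateField.adjoin.powerBasis ((hζ.isIntegral hn).tower_top (A := ℚ))
  have hdim : pb.dim = Nat.totient n := by
    rw [IntermediateField.adjoin.powerBasis_dim, ← cyclotomic_eq_minpoly_rat hζ hn,
      natDegree_cyclotomic]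
  refine ⟨pb.basis.reindex (finCongr hdim), fun i => ?_⟩
  simp [pb]

/-- The vectors are the columns of the Vandermonde matrix of the primitive roots. -/
theorem exists_powerVectors_basis {n : ℕ}
    (ω : Fin (Nat.totient n) ≃ {z : ℂ // IsPrimitiveRoot z n}) :
    ∃ e : Module.Basis (Fin (Nat.totient n)) ℂ (Fin (Nat.totient n) → ℂ),
      ∀ j, e j = fun i => (ω i : ℂ) ^ (j : ℕ) := by
  have hinj : Function.Injective fun i => (ω i : ℂ) := Subtype.val_injective.comp ω.injective
  have hli := Matrix.linearIndependent_cols_of_det_ne_zero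
    (Matrix.det_vandermonde_ne_zero_iff.2 hinj)
  refine ⟨basisOfLinearIndependentOfCardEqFinrank' _ hli (by simp), fun j => ?_⟩
  rw [coe_basisOfLinearIndependentOfCardEqFinrank']
  rfl

/-- Applying the embeddings `ζ ↦ ω i` to the expansion of `ζ ^ m` in the powers of `ζ` shows that
the vector `(ω i ^ m)` has the same coordinates in the corresponding power vectors. -/
theorem det_pow_eq_algebraMap_det_pow {n : ℕ} (hn : 0 < n) {ζ : ℂ} (hζ : IsPrimitiveRoot ζ n)
    (ω : Fin (Nat.totient n) ≃ {z : ℂ // IsPrimitiveRoot z n})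
    {e : Module.Basis (Fin (Nat.totient n)) ℚ ℚ⟮ζ⟯}
    (he : ∀ i, e i = IntermediateField.AdjoinSimple.gen ℚ ζ ^ (i : ℕ))
    {E : Module.Basis (Fin (Nat.totient n)) ℂ (Fin (Nat.totient n) → ℂ)}
    (hE : ∀ j, E j = fun i => (ω i : ℂ) ^ (j : ℕ)) (k : Fin (Nat.totient n) → ℕ) :
    E.det (fun j i => (ω i : ℂ) ^ k j) =
      algebraMap ℚ ℂ (e.det fun j => IntermediateField.AdjoinSimple.gen ℚ ζ ^ k j) := by
  have hrepr : ∀ (m : ℕ) (i : Fin (Nat.totient n)), E.repr (fun l => (ω l : ℂ) ^ m) i =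
      algebraMap ℚ ℂ (e.repr (IntermediateField.AdjoinSimple.gen ℚ ζ ^ m) i) := by
    intro m
    have hsum : (fun l => (ω l : ℂ) ^ m) = ∑ i,
        (algebraMap ℚ ℂ (e.repr (IntermediateField.AdjoinSimple.gen ℚ ζ ^ m) i)) • E i := by
      funext l
      have hroot : aeval (ω l : ℂ) (minpoly ℚ ζ) = 0 := by
        rw [← cyclotomic_eq_minpoly_rat hζ hn, cyclotomic_eq_minpoly_rat (ω l).2 hn,
          minpoly.aeval]
      let τ : ℚ⟮ζ⟯ →ₐ[ℚ] ℂ := (IntermediateField.algHomAdjoinIntegralEquiv ℚ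
        ((hζ.isIntegral hn).tower_top (A := ℚ))).symm ⟨ω l, by
          rw [mem_aroots]
          exact ⟨minpoly.ne_zero ((hζ.isIntegral hn).tower_top (A := ℚ)), hroot⟩⟩
      have hτ : τ (IntermediateField.AdjoinSimple.gen ℚ ζ) = ω l :=
        IntermediateField.algHomAdjoinIntegralEquiv_symm_apply_gen ℚ _ _
      have := congrArg τ (e.sum_repr (IntermediateField.AdjoinSimple.gen ℚ ζ ^ m))
      simp only [map_sum, map_rat_smul, map_pow, he, hτ] at this
      rw [← this]
      simp [hE, Algebra.smul_def]
    intro i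
    rw [hsum, E.repr_sum_self]
  rw [Module.Basis.det_apply, Module.Basis.det_apply, RingHom.map_det]
  congr 1
  ext i j
  simp [Module.Basis.toMatrix_apply, hrepr]

theorem proposition3p2 (n : ℕ) (hn : 0 < n) (ζ : ℂ) (hζ : IsPrimitiveRoot ζ n)
    (ω : Fin (Nat.totient n) ≃ {z : ℂ // IsPrimitiveRoot z n}) :
    rootsOfUnitySet n ⊆ (ℚ⟮ζ⟯ : Set ℂ) ∧
    (IsUnimodularSystem ℚ {z : ℚ⟮ζ⟯ | (z : ℂ) ∈ rootsOfUnitySet n} ↔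
      IsUnimodularSystem ℂ (powerVectors n (fun i => (ω i : ℂ)))) ∧
    (AtMostTwoOddPrimeFactors n →
      IsUnimodularSystem ℚ {z : ℚ⟮ζ⟯ | (z : ℂ) ∈ rootsOfUnitySet n} ∧
      IsUnimodularSystem ℂ (powerVectors n (fun i => (ω i : ℂ)))) := by
  have : NeZero n := ⟨hn.ne'⟩
  set g := IntermediateField.AdjoinSimple.gen ℚ ζ
  have hgζ : (g : ℂ) = ζ := IntermediateField.AdjoinSimple.coe_gen ℚ ζ
  obtain ⟨e, he⟩ := exists_powerBasis hn hζ
  obtain ⟨E, hE⟩ := exists_powerVectors_basis ω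
  have hZ : ∀ z : ℚ⟮ζ⟯, z ∈ {z : ℚ⟮ζ⟯ | (z : ℂ) ∈ rootsOfUnitySet n} ↔ ∃ k < n, z = g ^ k := by
    intro z
    constructor
    · intro hz
      obtain ⟨k, hk, h⟩ := hζ.eq_pow_of_pow_eq_one hz
      exact ⟨k, hk, Subtype.ext (by simp [hgζ, h])⟩
    · rintro ⟨k, -, rfl⟩
      change ((g ^ k : ℚ⟮ζ⟯) : ℂ) ^ n = 1
      rw [IntermediateField.coe_pow, hgζ, pow_right_comm, hζ.pow_eq_one, one_pow]
  have hφ : ∀ i : Fin (Nat.totient n), (i : ℕ) < n := fun i => i.2.trans_le (Nat.totient_le n)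
  have hZiff := isUnimodularSystem_iff (K := ℚ) (X := {z : ℚ⟮ζ⟯ | (z : ℂ) ∈ rootsOfUnitySet n})
    (by
      refine ((Set.finite_lt_nat n).image fun k => g ^ k).subset fun z hz => ?_
      obtain ⟨k, hk, rfl⟩ := (hZ z).1 hz
      exact ⟨k, hk, rfl⟩)
    (by
      intro h
      have h' : ((0 : ℚ⟮ζ⟯) : ℂ) ^ n = 1 := h
      simp [hn.ne'] at h')
    e (fun i => (hZ _).2 ⟨i, hφ i, he i⟩)
  have hΩiff := isUnimodularSystem_iff (K := ℂ) (X := powerVectors n fun i => (ω i : ℂ))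
    (by
      refine ((Set.finite_lt_nat n).image fun (k : ℕ) i => (ω i : ℂ) ^ k).subset ?_
      rintro v ⟨k, hk, rfl⟩
      exact ⟨k, hk, rfl⟩)
    (by
      rintro ⟨k, -, h⟩
      have h1 := congrFun h ⟨0, Nat.totient_pos.2 hn⟩
      exact pow_ne_zero k ((ω _).2.ne_zero hn.ne') h1.symm)
    E (fun i => ⟨i, hφ i, hE i⟩)
  have hiff : IsUnimodularSystem ℚ {z : ℚ⟮ζ⟯ | (z : ℂ) ∈ rootsOfUnitySet n} ↔
      IsUnimodularSystem ℂ (powerVectors n (fun i => (ω i : ℂ))) := by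
    have hcast : ∀ q : ℚ, (algebraMap ℚ ℂ q = 0 ∨ algebraMap ℚ ℂ q = 1 ∨ algebraMap ℚ ℂ q = -1) ↔
        (q = 0 ∨ q = 1 ∨ q = -1) := by
      intro q
      rw [eq_ratCast]
      norm_cast
    rw [hZiff, hΩiff]
    constructor
    · intro h v hv
      choose k hk hkv using hv
      obtain rfl : v = fun j i => (ω i : ℂ) ^ k j := funext hkv
      rw [det_pow_eq_algebraMap_det_pow hn hζ ω he hE, hcast]
      exact h _ fun i => (hZ _).2 ⟨k i, hk i, rfl⟩
    · intro h v hv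
      choose k hk hkv using fun i => (hZ _).1 (hv i)
      obtain rfl : v = fun j => g ^ k j := funext hkv
      rw [← hcast, ← det_pow_eq_algebraMap_det_pow hn hζ ω he hE]
      exact h _ fun i => ⟨k i, hk i, rfl⟩
  refine ⟨?_, hiff, fun hodd => ?_⟩
  · intro z hz
    obtain ⟨k, -, rfl⟩ := hζ.eq_pow_of_pow_eq_one hz
    exact pow_mem (IntermediateField.mem_adjoin_simple_self ℚ ζ) k
  -- Bases from `Z_n` have integral coordinates in each other, so the transition determinants are
  -- units of `ℤ`.
  suffices h : IsUnimodularSystem ℚ {z : ℚ⟮ζ⟯ | (z : ℂ) ∈ rootsOfUnitySet n} from ⟨h, hiff.1 h⟩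
  have hint : ∀ b : Module.Basis (Fin (Nat.totient n)) ℚ ℚ⟮ζ⟯, (∀ i, (b i : ℂ) ^ n = 1) →
      ∀ z : ℚ⟮ζ⟯, (z : ℂ) ^ n = 1 → ∀ i, ∃ m : ℤ, b.repr z i = m := by
    intro b hb z hz i
    refine isInt_coeff_of_pow_eq_one hζ hodd
      (b.linearIndependent.map' (ℚ⟮ζ⟯.val.toLinearMap)
        (LinearMap.ker_eq_bot.2 ℚ⟮ζ⟯.val.injective)) hb hz ?_ i
    have := congrArg ℚ⟮ζ⟯.val (b.sum_repr z)
    simp only [map_sum, map_rat_smul] at this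
    exact this
  rw [hZiff]
  intro v hv
  by_cases hdet : e.det v = 0
  · exact Or.inl hdet
  obtain ⟨hli, hsp⟩ := e.is_basis_iff_det.2 (isUnit_iff_ne_zero.2 hdet)
  have heX : ∀ i, (e i : ℂ) ^ n = 1 := fun i => (hZ _).2 ⟨i, hφ i, he i⟩
  have hbv : ⇑(Module.Basis.mk hli hsp.ge) = v := Module.Basis.coe_mk _ _
  have hbX : ∀ i, (Module.Basis.mk hli hsp.ge i : ℂ) ^ n = 1 := fun i => by rw [hbv]; exact hv i
  have := det_eq_one_or_neg_one_of_isInt e (Module.Basis.mk hli hsp.ge)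
    (fun i j => hint e heX _ (hbX j) i) (fun i j => hint _ hbX _ (heX j) i)
  rw [hbv] at this
  exact Or.inr this
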